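/- Let $\mathcal H,\mathcal H_1,\mathcal H_2$ be Hilbert spaces, all real or all complex, with inner products linear in the second argument and with fixed orthonormal bases $\{e_x\}_{x\in X}$, $\{f_y\}_{y\in Y}$, $\{g_z\}_{z\in Z}$ respectively (of arbitrary cardinality). A bounded operator $C$ is Hilbert–Schmidt if $\sum\|Ch\|^2<\infty$, where $h$ runs over the basis of its domain. With respect to these bases define, for bounded operators: the transpose $A^T:\mathcal H\to\mathcal H_1$ of $A:\mathcal H_1\to\mathcal H$ by $\langle f_y,A^Te_x\rangle=\langle e_x,Af_y\rangle$; the Schur product $M\circ N$ of $M,N:\mathcal H\to\mathcal H$ by $\langle e_x,(M\circ N)e_{x'}\rangle=\langle e_x,Me_{x'}\rangle\langle e_x,Ne_{x'}\rangle$; the diagonal vector $d_M\in\mathcal H$ of a Hilbert–Schmidt $M$ by $\langle e_x,d_M\rangle=\langle e_x,Me_x\rangle$; and, for $J\subset X$, the compression $M_{J\times J}=P_JMP_J$, where $P_J$ is the orthogonal projection onto the closed span of $\{e_x:x\in J\}$. For $d\in\mathcal H$ write $dd^*$ for the operator $u\mapsto\langle d,u\rangle d$, and let $S\ge T$ mean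 that $S-T$ is a positive (self-adjoint, with nonnegative quadratic form) operator. Let $C_1,C_2:\mathcal H_1\to\mathcal H$ and $C_3:\mathcal H_2\to\mathcal H$ be Hilbert–Schmidt, and let $J=\{x\in X: C_3^*e_x\neq 0\}$. Suppose that $(C_1C_1^*)_{J\times J}$ and $(C_2C_2^*)_{J\times J}$ are nonzero, let $r,s\in\{1,2,\dots\}\cup\{\infty\}$ be their ranks, and put $$\gamma(C_1,C_2,J)=\frac1{\min(r,s)},\qquad \tfrac1\infty:=0 .$$ Then $$C_3^*\,(C_1C_1^*\circ C_2C_2^*)\,C_3\ \ge\ \gamma(C_1,C_2,J)\; C_3^*\,d_{C_1C_2^T}\,d_{C_1C_2^T}^*\,C_3, \qquad(*)$$ and $\gamma(C_1,C_2,J)>0$ whenever at least one of $r,s$ is finite, also when $\mathcal H$ is infinite-dimensional. Moreover the coefficient is best possible: for fixed $C_3$ and every real $c>\gamma(C_1,C_2,J)$ there are Hilbert–Schmidt operators $A,B:\mathcal H_1\to\mathcal H$ such that $(AA^*)_{J\times J}$ and $(BB^*)_{J\times J}$ have the same ranks $r$ and $s$, but the inequality $(*)$ with $C_1,C_2,\gamma$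 replaced by $A,B,c$ fails. If at least one of $r,s$ is finite, a single pair $(A,B)$ can be chosen for which it fails for all $c>\gamma(C_1,C_2,J)$. -/

import Mathlib

open ContinuousLinearMap

set_option linter.unusedSectionVars false

namespace HilbertSchur

noncomputable section

section Basics

variable {𝕜 : Type*} [RCLike 𝕜]
  {E : Type*} [NormedAddCommGroup E] [InnerProductSpace 𝕜 E] [CompleteSpace E]
  {F : Type*} [NormedAddCommGroup F] [InnerProductSpace 𝕜 F] [CompleteSpace F]
  {ι : Type*} {κ : Type*}

/-- A bounded operator `A : E → F` is Hilbert–Schmidt if `∑ x, ‖A e_x‖² < ∞`, where `(e_x)` is the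
given orthonormal basis of `E`. -/
def IsHilbertSchmidt (b : HilbertBasis ι 𝕜 E) (A : E →L[𝕜] F) : Prop :=
  Summable fun x => ‖A (b x)‖ ^ 2

/-! ### Conjugation and transpose with respect to orthonormal bases -/

/-- Coordinatewise complex conjugation `u ↦ ū` with respect to an orthonormal basis. -/
def conjVec (b : HilbertBasis ι 𝕜 E) : E →L⋆[𝕜] E :=
  LinearMap.mkContinuous
    { toFun := fun u => b.repr.symm (star (b.repr u))
      map_add' := fun u v => by simp
      map_smul' := fun c u => by simp [star_smul] } 1
    (fun u => by simp)

theorem inner_conjVec (b : HilbertBasis ι 𝕜 E) (u : E) (x : ι) :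
    inner 𝕜 (b x) (conjVec b u) = inner 𝕜 u (b x) := by
  rw [← b.repr_apply_apply]
  simp [conjVec, b.repr_apply_apply]

/-- The transpose `Aᵀ : F → E` of `A : E → F` with respect to the orthonormal bases `(e_x)` of `E`
and `(f_y)` of `F`: `Aᵀ v = conj (A* (conj v))`. -/
def transpose (b : HilbertBasis ι 𝕜 E) (b' : HilbertBasis κ 𝕜 F) (A : E →L[𝕜] F) : F →L[𝕜] E :=
  (conjVec b).comp ((adjoint A).comp (conjVec b'))

theorem conjVec_basis (b : HilbertBasis ι 𝕜 E) (x : ι) : conjVec b (b x) = b x := by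
  classical
  apply b.repr.injective
  ext i
  rw [b.repr_apply_apply, b.repr_apply_apply, inner_conjVec]
  rw [orthonormal_iff_ite.mp b.orthonormal, orthonormal_iff_ite.mp b.orthonormal]
  simp [eq_comm]

theorem inner_transpose (b : HilbertBasis ι 𝕜 E) (b' : HilbertBasis κ 𝕜 F) (A : E →L[𝕜] F)
    (x : ι) (y : κ) :
    inner 𝕜 (b x) (transpose b b' A (b' y)) = inner 𝕜 (b' y) (A (b x)) := by
  simp only [transpose, ContinuousLinearMap.comp_apply]
  rw [inner_conjVec, conjVec_basis, adjoint_inner_left]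

/-! ### Vectors and operators given by their coordinates -/

theorem hasSum_normSq (b : HilbertBasis ι 𝕜 E) (u : E) :
    HasSum (fun x => ‖inner 𝕜 (b x) u‖ ^ 2) (‖u‖ ^ 2) := by
  have h := b.hasSum_inner_mul_inner u u
  rw [inner_self_eq_norm_sq_to_K] at h
  have h2 := RCLike.hasSum_re 𝕜 h
  convert! h2 using 1
  · funext x
    rw [← inner_conj_symm u (b x), RCLike.conj_mul]
    norm_cast
  · norm_cast

open Classical in
/-- The diagonal vector `d_A ∈ E` of `A : E → E`, i.e. the vector with coordinates
`⟨e_x, d_A⟩ = ⟨e_x, A e_x⟩`. It exists as soon as `A` is Hilbert–Schmidt (see `inner_diagVec`);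
by convention it is `0` if the diagonal of `A` is not square-summable. -/
def diagVec (b : HilbertBasis ι 𝕜 E) (A : E →L[𝕜] E) : E :=
  if h : Memℓp (fun x => inner 𝕜 (b x) (A (b x))) 2 then
    b.repr.symm ⟨fun x => inner 𝕜 (b x) (A (b x)), h⟩ else 0

theorem inner_diagVec (b : HilbertBasis ι 𝕜 E) (A : E →L[𝕜] E) (hA : IsHilbertSchmidt b A)
    (x : ι) : inner 𝕜 (b x) (diagVec b A) = inner 𝕜 (b x) (A (b x)) := by
  have h : Memℓp (fun x => inner 𝕜 (b x) (A (b x))) 2 := by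
    apply memℓp_gen
    simp only [ENNReal.toReal_ofNat, Real.rpow_ofNat]
    refine Summable.of_nonneg_of_le (fun _ => by positivity) (fun i => ?_) hA
    have := norm_inner_le_norm (𝕜 := 𝕜) (b i) (A (b i))
    rw [b.orthonormal.1 i, one_mul] at this
    gcongr
  rw [diagVec, dif_pos h, ← b.repr_apply_apply]
  simp

/-- If `A, B : E → F` and `B` is Hilbert–Schmidt then so is `A Bᵀ`; in particular the diagonal vector
of `A Bᵀ` exists. -/
theorem isHilbertSchmidt_comp_transpose (b : HilbertBasis ι 𝕜 E) (b' : HilbertBasis κ 𝕜 F)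
    (A B : E →L[𝕜] F) (hB : IsHilbertSchmidt b B) :
    IsHilbertSchmidt b' (A ∘L transpose b b' B) := by
  have hy : ∀ y, HasSum (fun x => ‖inner 𝕜 (b' y) (B (b x))‖ ^ 2) (‖transpose b b' B (b' y)‖ ^ 2) :=
    fun y => by simpa only [inner_transpose] using hasSum_normSq b (transpose b b' B (b' y))
  have hT : Summable fun y => ‖transpose b b' B (b' y)‖ ^ 2 := by
    refine summable_of_sum_le (c := ∑' x, ‖B (b x)‖ ^ 2) (fun y => sq_nonneg _) fun s => ?_
    have h := hasSum_sum (s := s) fun y _ => hy y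
    rw [← h.tsum_eq]
    exact h.summable.tsum_le_tsum
      (fun x => sum_le_hasSum s (fun _ _ => sq_nonneg _) (hasSum_normSq b' (B (b x)))) hB
  refine Summable.of_nonneg_of_le (fun _ => by positivity) (fun y => ?_) (hT.mul_left (‖A‖ ^ 2))
  rw [← mul_pow]
  gcongr
  exact A.le_opNorm _

/-! ### The Schur product -/

theorem tsum_mul_sq_le {f g : ι → ℝ} (hf0 : ∀ i, 0 ≤ f i) (hg0 : ∀ i, 0 ≤ g i)
    (hf : Summable fun i => f i ^ 2) (hg : Summable fun i => g i ^ 2) :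
    (Summable fun i => f i * g i) ∧
      (∑' i, f i * g i) ^ 2 ≤ (∑' i, f i ^ 2) * ∑' i, g i ^ 2 := by
  have hs : Summable fun i => f i * g i := by
    refine Summable.of_nonneg_of_le (fun i => mul_nonneg (hf0 i) (hg0 i)) (fun i => ?_) (hf.add hg)
    nlinarith [sq_nonneg (f i - g i), sq_nonneg (f i), sq_nonneg (g i)]
  refine ⟨hs, le_of_tendsto (hs.hasSum.pow 2) (Filter.Eventually.of_forall fun s => ?_)⟩
  refine (Finset.sum_mul_sq_le_sq_mul_sq s f g).trans ?_
  gcongr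
  · exact hf.sum_le_tsum s fun i _ => sq_nonneg _
  · exact hg.sum_le_tsum s fun i _ => sq_nonneg _

/-- The `y`-th coordinate `∑ x, ⟨f_y, A e_x⟩ ⟨f_y, B e_x⟩ ⟨e_x, u⟩` of `(A ∘ B) u`. -/
def schurCoord (b : HilbertBasis ι 𝕜 E) (b' : HilbertBasis κ 𝕜 F) (A B : E →L[𝕜] F) (u : E)
    (y : κ) : 𝕜 :=
  ∑' x, inner 𝕜 (b' y) (A (b x)) * inner 𝕜 (b' y) (B (b x)) * inner 𝕜 (b x) u

theorem summable_row (b : HilbertBasis ι 𝕜 E) (b' : HilbertBasis κ 𝕜 F) (B : E →L[𝕜] F) (y : κ) :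
    (Summable fun x => ‖inner 𝕜 (b' y) (B (b x))‖ ^ 2) ∧
      ∑' x, ‖inner 𝕜 (b' y) (B (b x))‖ ^ 2 ≤ ‖B‖ ^ 2 := by
  have h := hasSum_normSq b (adjoint B (b' y))
  have e : (fun x => ‖inner 𝕜 (b x) (adjoint B (b' y))‖ ^ 2) =
      fun x => ‖inner 𝕜 (b' y) (B (b x))‖ ^ 2 := by
    funext x
    rw [adjoint_inner_right, norm_inner_symm]
  rw [e] at h
  refine ⟨h.summable, ?_⟩
  rw [h.tsum_eq]
  gcongr
  have := (adjoint B).le_opNorm (b' y)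
  rw [b'.orthonormal.1 y, mul_one] at this
  simpa using this

theorem summable_weighted (b : HilbertBasis ι 𝕜 E) (b' : HilbertBasis κ 𝕜 F) (A : E →L[𝕜] F)
    (u : E) (y : κ) :
    Summable fun x => (‖inner 𝕜 (b' y) (A (b x))‖ * ‖inner 𝕜 (b x) u‖) ^ 2 := by
  refine Summable.of_nonneg_of_le (fun _ => by positivity) (fun x => ?_)
    ((summable_row b b' A y).1.mul_right (‖u‖ ^ 2))
  rw [mul_pow]
  gcongr
  have := norm_inner_le_norm (𝕜 := 𝕜) (b x) u
  rwa [b.orthonormal.1 x, one_mul] at this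

theorem summable_schurCoord (b : HilbertBasis ι 𝕜 E) (b' : HilbertBasis κ 𝕜 F) (A B : E →L[𝕜] F)
    (u : E) (y : κ) :
    (Summable fun x =>
      ‖inner 𝕜 (b' y) (A (b x)) * inner 𝕜 (b' y) (B (b x)) * inner 𝕜 (b x) u‖) ∧
    ‖schurCoord b b' A B u y‖ ^ 2 ≤
      (∑' x, (‖inner 𝕜 (b' y) (A (b x))‖ * ‖inner 𝕜 (b x) u‖) ^ 2) * ‖B‖ ^ 2 := by
  obtain ⟨h1, h2⟩ := tsum_mul_sq_le
    (f := fun x => ‖inner 𝕜 (b' y) (A (b x))‖ * ‖inner 𝕜 (b x) u‖)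
    (g := fun x => ‖inner 𝕜 (b' y) (B (b x))‖)
    (fun _ => by positivity) (fun _ => by positivity)
    (summable_weighted b b' A u y) (summable_row b b' B y).1
  have e : (fun x => ‖inner 𝕜 (b' y) (A (b x)) * inner 𝕜 (b' y) (B (b x)) * inner 𝕜 (b x) u‖) =
      fun x => ‖inner 𝕜 (b' y) (A (b x))‖ * ‖inner 𝕜 (b x) u‖ * ‖inner 𝕜 (b' y) (B (b x))‖ := by
    funext x
    rw [norm_mul, norm_mul]
    ring
  have hs := h1
  rw [← e] at hs
  refine ⟨hs, ?_⟩
  calc ‖schurCoord b b' A B u y‖ ^ 2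
      ≤ (∑' x, ‖inner 𝕜 (b' y) (A (b x)) * inner 𝕜 (b' y) (B (b x)) * inner 𝕜 (b x) u‖) ^ 2 := by
        gcongr
        exact norm_tsum_le_tsum_norm hs
    _ ≤ _ := by
        rw [e]
        refine h2.trans ?_
        gcongr
        exact (summable_row b b' B y).2

theorem sum_schurCoord_le (b : HilbertBasis ι 𝕜 E) (b' : HilbertBasis κ 𝕜 F) (A B : E →L[𝕜] F)
    (u : E) (s : Finset κ) :
    ∑ y ∈ s, ‖schurCoord b b' A B u y‖ ^ 2 ≤ (‖A‖ * ‖B‖ * ‖u‖) ^ 2 := by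
  have h1 : ∀ x, ∑ y ∈ s, (‖inner 𝕜 (b' y) (A (b x))‖ * ‖inner 𝕜 (b x) u‖) ^ 2 ≤
      ‖A‖ ^ 2 * ‖inner 𝕜 (b x) u‖ ^ 2 := fun x => by
    simp_rw [mul_pow]
    rw [← Finset.sum_mul]
    gcongr
    have h := hasSum_normSq b' (A (b x))
    refine (sum_le_hasSum s (fun _ _ => sq_nonneg _) h).trans ?_
    gcongr
    have := A.le_opNorm (b x)
    rwa [b.orthonormal.1 x, mul_one] at this
  have hu := (hasSum_normSq b u).mul_left (‖A‖ ^ 2)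
  calc ∑ y ∈ s, ‖schurCoord b b' A B u y‖ ^ 2
      ≤ ∑ y ∈ s,
          (∑' x, (‖inner 𝕜 (b' y) (A (b x))‖ * ‖inner 𝕜 (b x) u‖) ^ 2) * ‖B‖ ^ 2 :=
        Finset.sum_le_sum fun y _ => (summable_schurCoord b b' A B u y).2
    _ = (∑' x, ∑ y ∈ s, (‖inner 𝕜 (b' y) (A (b x))‖ * ‖inner 𝕜 (b x) u‖) ^ 2) * ‖B‖ ^ 2 := by
        rw [← Finset.sum_mul, Summable.tsum_finsetSum fun y _ => summable_weighted b b' A u y]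
    _ ≤ (‖A‖ ^ 2 * ‖u‖ ^ 2) * ‖B‖ ^ 2 := by
        gcongr
        rw [← hu.tsum_eq]
        exact Summable.tsum_le_tsum h1
          (summable_sum fun y _ => summable_weighted b b' A u y) hu.summable
    _ = _ := by ring

theorem memlp_schurCoord (b : HilbertBasis ι 𝕜 E) (b' : HilbertBasis κ 𝕜 F) (A B : E →L[𝕜] F)
    (u : E) : Memℓp (schurCoord b b' A B u) 2 := by
  refine memℓp_gen' (C := (‖A‖ * ‖B‖ * ‖u‖) ^ 2) fun s => ?_
  simpa using sum_schurCoord_le b b' A B u s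

/-- The Schur (entrywise) product `A ∘ B : E → F` of bounded operators `A, B : E → F` with respect
to the orthonormal bases `(e_x)` of `E` and `(f_y)` of `F`. -/
def schurProd (b : HilbertBasis ι 𝕜 E) (b' : HilbertBasis κ 𝕜 F) (A B : E →L[𝕜] F) :
    E →L[𝕜] F :=
  LinearMap.mkContinuous
    { toFun := fun u => b'.repr.symm ⟨schurCoord b b' A B u, memlp_schurCoord b b' A B u⟩
      map_add' := fun u v => by
        rw [← map_add]
        congr 1
        ext y
        simp only [schurCoord, lp.coeFn_add, Pi.add_apply]
        rw [← Summable.tsum_add (summable_schurCoord b b' A B u y).1.of_norm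
          (summable_schurCoord b b' A B v y).1.of_norm]
        simp only [inner_add_right, mul_add]
      map_smul' := fun c u => by
        rw [RingHom.id_apply, ← map_smul]
        congr 1
        ext y
        simp only [schurCoord, lp.coeFn_smul, Pi.smul_apply, smul_eq_mul]
        rw [← tsum_mul_left]
        refine tsum_congr fun x => ?_
        rw [inner_smul_right]
        ring }
    (‖A‖ * ‖B‖) (fun u => by
      simp only [LinearMap.coe_mk, AddHom.coe_mk, LinearIsometryEquiv.norm_map]
      refine lp.norm_le_of_forall_sum_le (by norm_num) (by positivity) fun s => ?_
      simpa using sum_schurCoord_le b b' A B u s)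

/-- The entries of the Schur product are the products of the entries. -/
theorem inner_schurProd (b : HilbertBasis ι 𝕜 E) (b' : HilbertBasis κ 𝕜 F) (A B : E →L[𝕜] F)
    (x : ι) (y : κ) :
    inner 𝕜 (b' y) (schurProd b b' A B (b x)) =
      inner 𝕜 (b' y) (A (b x)) * inner 𝕜 (b' y) (B (b x)) := by
  classical
  rw [← b'.repr_apply_apply]
  simp only [schurProd, LinearMap.mkContinuous_apply, LinearMap.coe_mk, AddHom.coe_mk,
    LinearIsometryEquiv.apply_symm_apply, schurCoord]
  rw [tsum_eq_single x]
  · simp [b.orthonormal.1 x]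
  · intro x' hx'
    simp [orthonormal_iff_ite.mp b.orthonormal, hx']

/-! ### Principal compressions, ranks, and the coefficient -/

/-- The principal compression `A_{J×J} = P_J A P_J`, where `P_J` is the orthogonal projection onto
the closed span of `{e_x : x ∈ J}`. -/
def compression (b : HilbertBasis ι 𝕜 E) (J : Set ι) (A : E →L[𝕜] E) : E →L[𝕜] E :=
  let P : E →L[𝕜] E := (Submodule.span 𝕜 (b '' J)).topologicalClosure.starProjection
  P ∘L A ∘L P

/-- The rank of an operator, as an element of `ℕ ∪ {∞}`. -/
def opRank (A : E →L[𝕜] E) : ℕ∞ := Cardinal.toENat (LinearMap.rank (A : E →ₗ[𝕜] E))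

end Basics

section Main

variable {𝕜 : Type*} [RCLike 𝕜]
  {H : Type*} [NormedAddCommGroup H] [InnerProductSpace 𝕜 H] [CompleteSpace H]
  {H₁ : Type*} [NormedAddCommGroup H₁] [InnerProductSpace 𝕜 H₁] [CompleteSpace H₁]
  {H₂ : Type*} [NormedAddCommGroup H₂] [InnerProductSpace 𝕜 H₂] [CompleteSpace H₂]
  {X : Type*} {Y : Type*}

/-- `rk (C C*)_{J×J}`. -/
def gramRank (b : HilbertBasis X 𝕜 H) (J : Set X) (C : H₁ →L[𝕜] H) : ℕ∞ :=
  opRank (compression b J (C ∘L adjoint C))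

/-- `γ(C₁, C₂, J) = 1 / min (rk (C₁ C₁*)_{J×J}, rk (C₂ C₂*)_{J×J})`, with `1 / ∞ = 0`. -/
def gammaCoeff (b : HilbertBasis X 𝕜 H) (J : Set X) (C₁ C₂ : H₁ →L[𝕜] H) : ℝ :=
  (((min (gramRank b J C₁) (gramRank b J C₂) : ℕ∞) : ENNReal)⁻¹).toReal

/-- The set `J = {x : C₃* e_x ≠ 0}`. -/
def rowSupport (b : HilbertBasis X 𝕜 H) (C₃ : H₂ →L[𝕜] H) : Set X :=
  {x | adjoint C₃ (b x) ≠ 0}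

/-- The inequality `C₃* (C₁ C₁* ∘ C₂ C₂*) C₃ ≥ c • C₃* d d* C₃` in the Loewner order, where
`d` is the diagonal vector of `C₁ C₂ᵀ`. -/
def SchurLowerBound (b : HilbertBasis X 𝕜 H) (b₁ : HilbertBasis Y 𝕜 H₁)
    (C₁ C₂ : H₁ →L[𝕜] H) (C₃ : H₂ →L[𝕜] H) (c : ℝ) : Prop :=
  let d : H := diagVec b (C₁ ∘L transpose b₁ b C₂)
  (c : 𝕜) • (adjoint C₃ ∘L InnerProductSpace.rankOne 𝕜 d d ∘L C₃) ≤
    adjoint C₃ ∘L schurProd b b (C₁ ∘L adjoint C₁) (C₂ ∘L adjoint C₂) ∘L C₃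

end Main

end

end HilbertSchur

namespace HilbertSchur

open scoped TensorProduct

/-! ### Entrywise identities and the reduction to quadratic forms. -/

section General

variable {𝕜 : Type*} [RCLike 𝕜]
  {E : Type*} [NormedAddCommGroup E] [InnerProductSpace 𝕜 E] [CompleteSpace E]
  {F : Type*} [NormedAddCommGroup F] [InnerProductSpace 𝕜 F] [CompleteSpace F]
  {G : Type*} [NormedAddCommGroup G] [InnerProductSpace 𝕜 G] [CompleteSpace G]
  {ι : Type*} {κ : Type*}

/-! Lower bound. Put `a_x = C₁* e_x` and `b_x = C₂* e_x`. The Schur product of the two Gram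
operators is the Gram operator of the tensors `a_x ⊗ b_x`, so its form at `v = ∑ v_x e_x` is `‖τ‖²`
with `τ = ∑ v_x a_x ⊗ b_x` (`inner_schurProd_sum`). Let `W` be a finite-dimensional space containing
every `a_x` with `x ∈ J`, with orthonormal basis `w_k`, and let `g = ∑ w_k ⊗ conj w_k`. Then `‖g‖² =
dim W`, and expanding `a_x` in the `w_k` gives `⟨g, τ⟩ = ⟨d, v⟩`. Cauchy–Schwarz yields `|⟨d, v⟩|² ≤
dim W · ‖τ‖²` (`norm_inner_diagVec_sum_sq_le`). The smallest such `W`, the range of `C₁* P_J`, has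
dimension `rk (C₁C₁*)_{J×J}` (`gramRank_eq`), and vectors `v = C₃ u` are supported in `J`. Only one
of the two ranks is used; exchanging `C₁` and `C₂` gives the minimum. If both ranks are infinite the
coefficient is `0` and only positivity of the Schur product is needed.

Sharpness. Take diagonal operators `A = ∑ α_k e_{x_k} f_{y_k}*` and `B = ∑ β_k e_{x_k} f_{y_k}*`,
whose ranks are the sizes of the supports of `α` and `β`. If the supports meet in exactly `m`
indices, both sides of the inequality involve those indices only. Normalising the weights against a
suitable `C₃ u` makes each index contribute `1`, and the inequality becomes `c m² ≤ m`
(`mul_card_sq_le_of_schurLowerBound_diagOp`). With a finite minimal rank take `m = min(r, s)`; with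
both ranks infinite `m` is arbitrary, and `m > 1/c` defeats a given `c > 0`. -/

theorem ext_inner_basis (b : HilbertBasis ι 𝕜 E) {u v : E}
    (h : ∀ x, inner 𝕜 (b x) u = inner 𝕜 (b x) v) : u = v := by
  apply b.repr.injective
  ext x
  simpa only [b.repr_apply_apply] using h x

theorem ext_basis (b : HilbertBasis ι 𝕜 E) {S T : E →L[𝕜] F} (h : ∀ x, S (b x) = T (b x)) :
    S = T := by
  refine ContinuousLinearMap.ext_on (s := Set.range b) ?_ ?_
  · rw [dense_iff_closure_eq, ← Submodule.topologicalClosure_coe, b.dense_span]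
    rfl
  · rintro _ ⟨x, rfl⟩
    exact h x

theorem ext_entries (b : HilbertBasis ι 𝕜 E) (b' : HilbertBasis κ 𝕜 F) {S T : E →L[𝕜] F}
    (h : ∀ x y, inner 𝕜 (b' y) (S (b x)) = inner 𝕜 (b' y) (T (b x))) : S = T :=
  ext_basis b fun x => ext_inner_basis b' fun y => h x y

/-- In coordinates both sides are the sum of `conj u_x * conj v_x`. This symmetry is what makes the
diagonal of `A Bᵀ` equal to that of `B Aᵀ`. -/
theorem inner_conjVec_comm (b : HilbertBasis ι 𝕜 E) (u v : E) :
    inner 𝕜 u (conjVec b v) = inner 𝕜 v (conjVec b u) := by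
  rw [← b.tsum_inner_mul_inner u, ← b.tsum_inner_mul_inner v]
  refine tsum_congr fun x => ?_
  rw [inner_conjVec, inner_conjVec, mul_comm]

theorem inner_conjVec_conjVec (b : HilbertBasis ι 𝕜 E) (u v : E) :
    inner 𝕜 (conjVec b u) (conjVec b v) = inner 𝕜 v u := by
  rw [← b.tsum_inner_mul_inner, ← b.tsum_inner_mul_inner v]
  refine tsum_congr fun x => ?_
  rw [inner_conjVec, ← inner_conj_symm, inner_conjVec, inner_conj_symm, mul_comm]

theorem transpose_basis (b : HilbertBasis ι 𝕜 E) (b' : HilbertBasis κ 𝕜 F) (A : E →L[𝕜] F)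
    (y : κ) : transpose b b' A (b' y) = conjVec b (adjoint A (b' y)) := by
  simp only [transpose, ContinuousLinearMap.comp_apply, conjVec_basis]

/-- The diagonal entries of `A Bᵀ`. -/
theorem inner_diagVec_comp_transpose (b : HilbertBasis ι 𝕜 E) (b' : HilbertBasis κ 𝕜 F)
    (A B : E →L[𝕜] F) (hB : IsHilbertSchmidt b B) (y : κ) :
    inner 𝕜 (b' y) (diagVec b' (A ∘L transpose b b' B)) =
      inner 𝕜 (adjoint A (b' y)) (conjVec b (adjoint B (b' y))) := by
  rw [inner_diagVec _ _ (isHilbertSchmidt_comp_transpose b b' A B hB),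
    ContinuousLinearMap.comp_apply, transpose_basis, adjoint_inner_left]

theorem diagVec_comp_transpose_comm (b : HilbertBasis ι 𝕜 E) (b' : HilbertBasis κ 𝕜 F)
    (A B : E →L[𝕜] F) (hA : IsHilbertSchmidt b A) (hB : IsHilbertSchmidt b B) :
    diagVec b' (A ∘L transpose b b' B) = diagVec b' (B ∘L transpose b b' A) :=
  ext_inner_basis b' fun y => by
    rw [inner_diagVec_comp_transpose b b' A B hB, inner_diagVec_comp_transpose b b' B A hA,
      inner_conjVec_comm]

theorem schurProd_comm (b : HilbertBasis ι 𝕜 E) (b' : HilbertBasis κ 𝕜 F) (A B : E →L[𝕜] F) :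
    schurProd b b' A B = schurProd b b' B A :=
  ext_entries b b' fun x y => by rw [inner_schurProd, inner_schurProd, mul_comm]

theorem isSelfAdjoint_schurProd (b : HilbertBasis ι 𝕜 E) {A B : E →L[𝕜] E}
    (hA : IsSelfAdjoint A) (hB : IsSelfAdjoint B) : IsSelfAdjoint (schurProd b b A B) := by
  rw [isSelfAdjoint_iff']
  refine ext_entries b b fun x y => ?_
  rw [adjoint_inner_right, ← inner_conj_symm, inner_schurProd, inner_schurProd, map_mul,
    inner_conj_symm, inner_conj_symm]
  congr 1
  · exact (isSelfAdjoint_iff_isSymmetric.mp hA) _ _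
  · exact (isSelfAdjoint_iff_isSymmetric.mp hB) _ _

theorem isSelfAdjoint_comp_adjoint (A : E →L[𝕜] F) : IsSelfAdjoint (A ∘L adjoint A) := by
  rw [isSelfAdjoint_iff', adjoint_comp, adjoint_adjoint]

/-- Both operators are self-adjoint, so the Loewner order reduces to the real parts of their
quadratic forms. After this, `C₃` enters only through the vectors `C₃ u`. -/
theorem schurLowerBound_iff (b : HilbertBasis ι 𝕜 E) (b₁ : HilbertBasis κ 𝕜 F)
    (C₁ C₂ : F →L[𝕜] E) (C₃ : G →L[𝕜] E) (c : ℝ) :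
    SchurLowerBound b b₁ C₁ C₂ C₃ c ↔ ∀ u,
      c * ‖inner 𝕜 (diagVec b (C₁ ∘L transpose b₁ b C₂)) (C₃ u)‖ ^ 2 ≤
        RCLike.re (inner 𝕜 (C₃ u)
          (schurProd b b (C₁ ∘L adjoint C₁) (C₂ ∘L adjoint C₂) (C₃ u))) := by
  set S := schurProd b b (C₁ ∘L adjoint C₁) (C₂ ∘L adjoint C₂) with hS
  set d := diagVec b (C₁ ∘L transpose b₁ b C₂) with hd
  have hSs : IsSelfAdjoint S :=
    isSelfAdjoint_schurProd b (isSelfAdjoint_comp_adjoint C₁) (isSelfAdjoint_comp_adjoint C₂)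
  have e : adjoint C₃ ∘L S ∘L C₃ -
      (c : 𝕜) • (adjoint C₃ ∘L InnerProductSpace.rankOne 𝕜 d d ∘L C₃) =
      adjoint C₃ ∘L (S - (c : 𝕜) • InnerProductSpace.rankOne 𝕜 d d) ∘L C₃ := by
    ext u
    simp
  have hsa : IsSelfAdjoint
      (adjoint C₃ ∘L (S - (c : 𝕜) • InnerProductSpace.rankOne 𝕜 d d) ∘L C₃) := by
    apply IsSelfAdjoint.adjoint_conj
    refine hSs.sub (IsSelfAdjoint.smul ?_
      (InnerProductSpace.isPositive_rankOne_self d).isSelfAdjoint)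
    simp [isSelfAdjoint_iff]
  unfold SchurLowerBound
  simp only [← hS, ← hd]
  rw [ContinuousLinearMap.le_def, e, isPositive_def']
  simp only [hsa, true_and]
  refine forall_congr' fun u => ?_
  have : RCLike.re (inner 𝕜 ((adjoint C₃ ∘L (S - (c : 𝕜) • InnerProductSpace.rankOne 𝕜 d d) ∘L C₃) u) u)
      = RCLike.re (inner 𝕜 (C₃ u) (S (C₃ u))) - c * ‖inner 𝕜 d (C₃ u)‖ ^ 2 := by
    simp only [ContinuousLinearMap.comp_apply, adjoint_inner_left, sub_apply,
      smul_apply, InnerProductSpace.rankOne_apply, inner_sub_left,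
      inner_smul_left, map_sub, RCLike.conj_ofReal]
    rw [RCLike.conj_mul, RCLike.re_ofReal_mul]
    congr 1
    · exact congrArg _ ((isSelfAdjoint_iff_isSymmetric.mp hSs) _ _)
    · norm_cast
  rw [reApplyInnerSelf_apply, this, sub_nonneg]

theorem schurLowerBound_comm (b : HilbertBasis ι 𝕜 E) (b₁ : HilbertBasis κ 𝕜 F)
    {C₁ C₂ : F →L[𝕜] E} (h₁ : IsHilbertSchmidt b₁ C₁) (h₂ : IsHilbertSchmidt b₁ C₂)
    (C₃ : G →L[𝕜] E) (c : ℝ) :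
    SchurLowerBound b b₁ C₁ C₂ C₃ c ↔ SchurLowerBound b b₁ C₂ C₁ C₃ c := by
  unfold SchurLowerBound
  rw [diagVec_comp_transpose_comm b₁ b C₁ C₂ h₁ h₂, schurProd_comm]

/-! ### The lower bound -/

/-- The quadratic form of `A A* ∘ B B*` on finitely supported vectors is a squared tensor norm. -/
theorem inner_schurProd_sum (b : HilbertBasis ι 𝕜 E) (A B : F →L[𝕜] E) (s : Finset ι)
    (c : ι → 𝕜) :
    inner 𝕜 (∑ x ∈ s, c x • b x)
        (schurProd b b (A ∘L adjoint A) (B ∘L adjoint B) (∑ x ∈ s, c x • b x)) =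
      inner 𝕜 (∑ x ∈ s, c x • (adjoint A (b x) ⊗ₜ[𝕜] adjoint B (b x)))
        (∑ x ∈ s, c x • (adjoint A (b x) ⊗ₜ[𝕜] adjoint B (b x))) := by
  simp only [map_sum, map_smul, sum_inner, inner_sum, inner_smul_left, inner_smul_right,
    inner_schurProd, TensorProduct.inner_tmul, ContinuousLinearMap.comp_apply, adjoint_inner_left]

/-- The Schur product theorem: a squared tensor norm on finitely supported vectors, then a limit. -/
theorem re_inner_schurProd_nonneg (b : HilbertBasis ι 𝕜 E) (A B : F →L[𝕜] E) (v : E) :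
    0 ≤ RCLike.re (inner 𝕜 v (schurProd b b (A ∘L adjoint A) (B ∘L adjoint B) v)) := by
  have hv := b.hasSum_repr v
  have hc : Continuous fun w : E => RCLike.re (inner 𝕜 w
      (schurProd b b (A ∘L adjoint A) (B ∘L adjoint B) w)) := by fun_prop
  refine ge_of_tendsto' ((hc.tendsto v).comp hv) fun s => ?_
  simp only [Function.comp_apply]
  rw [inner_schurProd_sum]
  exact inner_self_nonneg

/-- Cauchy–Schwarz between `τ` and the tensor `g` that represents the identity of `W`. Finite sums
keep everything inside the algebraic tensor product, so no completion is needed. -/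
theorem norm_inner_diagVec_sum_sq_le (b : HilbertBasis ι 𝕜 E) (b₁ : HilbertBasis κ 𝕜 F)
    {A B : F →L[𝕜] E} (hB : IsHilbertSchmidt b₁ B) (W : Submodule 𝕜 F) [FiniteDimensional 𝕜 W]
    (s : Finset ι) (c : ι → 𝕜) (hW : ∀ x ∈ s, c x ≠ 0 → adjoint A (b x) ∈ W) :
    ‖inner 𝕜 (diagVec b (A ∘L transpose b₁ b B)) (∑ x ∈ s, c x • b x)‖ ^ 2 ≤
      Module.finrank 𝕜 W * RCLike.re (inner 𝕜 (∑ x ∈ s, c x • b x)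
        (schurProd b b (A ∘L adjoint A) (B ∘L adjoint B) (∑ x ∈ s, c x • b x))) := by
  let w := stdOrthonormalBasis 𝕜 W
  let g : F ⊗[𝕜] F := ∑ k, (w k : F) ⊗ₜ[𝕜] conjVec b₁ (w k)
  let τ : F ⊗[𝕜] F := ∑ x ∈ s, c x • (adjoint A (b x) ⊗ₜ[𝕜] adjoint B (b x))
  have ho : ∀ i j, inner 𝕜 (w i : F) (w j : F) = if i = j then 1 else 0 := fun i j => by
    rw [← Submodule.coe_inner]
    exact orthonormal_iff_ite.mp w.orthonormal i j
  have hg : ‖g‖ ^ 2 = Module.finrank 𝕜 W := by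
    have : (inner 𝕜 g g : 𝕜) = (Module.finrank 𝕜 W : 𝕜) := by
      simp only [g, sum_inner, inner_sum, TensorProduct.inner_tmul, inner_conjVec_conjVec, ho]
      simp
    rw [← inner_self_eq_norm_sq (𝕜 := 𝕜), this]
    simp
  have hd : inner 𝕜 (diagVec b (A ∘L transpose b₁ b B)) (∑ x ∈ s, c x • b x) = inner 𝕜 g τ := by
    simp only [g, τ, sum_inner, inner_sum, inner_smul_right, TensorProduct.inner_tmul]
    refine Finset.sum_congr rfl fun x hx => ?_
    by_cases hc : c x = 0
    · simp [hc]
    congr 1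
    rw [← inner_conj_symm, inner_diagVec_comp_transpose b₁ b A B hB, inner_conj_symm]
    -- Only the first tensor factor has to lie in `W`; nothing is required of `adjoint B (b x)`.
    have ha : adjoint A (b x) = ∑ k, inner 𝕜 (w k : F) (adjoint A (b x)) • (w k : F) := by
      have := congrArg (Subtype.val) (w.sum_repr' ⟨adjoint A (b x), hW x hx hc⟩)
      simpa [Submodule.coe_inner] using this.symm
    conv_lhs => rw [ha]
    rw [inner_sum]
    refine Finset.sum_congr rfl fun k _ => ?_
    rw [inner_smul_right]
    congr 1
    rw [← inner_conj_symm, inner_conjVec_comm, inner_conj_symm]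
  rw [hd, inner_schurProd_sum, ← hg, inner_self_eq_norm_sq]
  calc ‖inner 𝕜 g τ‖ ^ 2 ≤ (‖g‖ * ‖τ‖) ^ 2 := by
        gcongr
        exact norm_inner_le_norm _ _
    _ = _ := mul_pow _ _ _

theorem norm_inner_diagVec_sq_le (b : HilbertBasis ι 𝕜 E) (b₁ : HilbertBasis κ 𝕜 F)
    {A B : F →L[𝕜] E} (hB : IsHilbertSchmidt b₁ B) (W : Submodule 𝕜 F) [FiniteDimensional 𝕜 W]
    (v : E) (hW : ∀ x, inner 𝕜 (b x) v ≠ 0 → adjoint A (b x) ∈ W) :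
    ‖inner 𝕜 (diagVec b (A ∘L transpose b₁ b B)) v‖ ^ 2 ≤
      Module.finrank 𝕜 W * RCLike.re (inner 𝕜 v
        (schurProd b b (A ∘L adjoint A) (B ∘L adjoint B) v)) := by
  have hv := b.hasSum_repr v
  have hc₁ : Continuous fun w : E =>
      ‖inner 𝕜 (diagVec b (A ∘L transpose b₁ b B)) w‖ ^ 2 := by fun_prop
  have hc₂ : Continuous fun w : E => Module.finrank 𝕜 W * RCLike.re (inner 𝕜 w
      (schurProd b b (A ∘L adjoint A) (B ∘L adjoint B) w)) := by fun_prop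
  -- The partial sums of the expansion of `v` have no coordinates outside the support of `v`, so the
  -- same `W` serves all of them.
  refine le_of_tendsto_of_tendsto' ((hc₁.tendsto v).comp hv) ((hc₂.tendsto v).comp hv) fun s => ?_
  refine norm_inner_diagVec_sum_sq_le b b₁ hB W s _ fun x _ hx => hW x ?_
  rwa [b.repr_apply_apply] at hx

/-! ### Compressions and ranks -/

theorem starProjection_basis_of_mem (b : HilbertBasis ι 𝕜 E) {J : Set ι} {x : ι} (hx : x ∈ J) :
    (Submodule.span 𝕜 (b '' J)).topologicalClosure.starProjection (b x) = b x :=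
  Submodule.starProjection_eq_self_iff.mpr
    (Submodule.le_topologicalClosure _ (Submodule.subset_span ⟨x, hx, rfl⟩))

theorem starProjection_basis_of_notMem (b : HilbertBasis ι 𝕜 E) {J : Set ι} {x : ι}
    (hx : x ∉ J) :
    (Submodule.span 𝕜 (b '' J)).topologicalClosure.starProjection (b x) = 0 := by
  rw [Submodule.starProjection_apply_eq_zero_iff, Submodule.orthogonal_closure,
    Submodule.mem_orthogonal]
  intro u hu
  induction hu using Submodule.span_induction with
  | mem u hu =>
    obtain ⟨y, hy, rfl⟩ := hu
    exact b.orthonormal.2 fun h => hx (h ▸ hy)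
  | zero => simp
  | add u v _ _ hu hv => rw [inner_add_left, hu, hv, add_zero]
  | smul c u _ hu => rw [inner_smul_left, hu, mul_zero]

/-- The rank of `(C C*)_{J×J}` is the dimension of the range of `C* P_J`. -/
theorem gramRank_eq (b : HilbertBasis ι 𝕜 E) (J : Set ι) (C : F →L[𝕜] E) :
    gramRank b J C = Cardinal.toENat (Module.rank 𝕜 (LinearMap.range
      ((adjoint C ∘L (Submodule.span 𝕜 (b '' J)).topologicalClosure.starProjection :
        E →L[𝕜] F) : E →ₗ[𝕜] F))) := by
  set P := (Submodule.span 𝕜 (b '' J)).topologicalClosure.starProjection with hP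
  have hPs : adjoint P = P := isSelfAdjoint_iff'.mp (isSelfAdjoint_starProjection _)
  set D : E →L[𝕜] F := adjoint C ∘L P with hD
  have hM : compression b J (C ∘L adjoint C) = adjoint D ∘L D := by
    rw [hD, adjoint_comp, hPs, adjoint_adjoint]
    rfl
  -- `D*D` and `D` have the same kernel, hence isomorphic ranges; no closedness of the ranges is
  -- involved.
  have hker : LinearMap.ker ((adjoint D ∘L D : E →L[𝕜] E) : E →ₗ[𝕜] E) =
      LinearMap.ker (D : E →ₗ[𝕜] F) := by
    ext u
    simp only [LinearMap.mem_ker, ContinuousLinearMap.coe_coe, ContinuousLinearMap.comp_apply]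
    refine ⟨fun h => ?_, fun h => by rw [h, map_zero]⟩
    rw [← inner_self_eq_zero (𝕜 := 𝕜), ← adjoint_inner_left, h, inner_zero_left]
  have e := ((LinearMap.quotKerEquivRange
    ((adjoint D ∘L D : E →L[𝕜] E) : E →ₗ[𝕜] E)).symm.trans
      (Submodule.quotEquivOfEq _ _ hker)).trans (LinearMap.quotKerEquivRange (D : E →ₗ[𝕜] F))
  unfold gramRank opRank LinearMap.rank
  -- The two ranges may live in different universes, which is invisible in `ℕ∞`.
  rw [hM, ← Cardinal.toENat_lift, e.lift_rank_eq, Cardinal.toENat_lift]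

theorem gramRank_ne_zero (b : HilbertBasis ι 𝕜 E) (J : Set ι) (C : F →L[𝕜] E)
    (h : compression b J (C ∘L adjoint C) ≠ 0) : gramRank b J C ≠ 0 := by
  unfold gramRank opRank
  rw [Ne, Cardinal.toENat_eq_zero, LinearMap.rank, Submodule.rank_eq_zero, LinearMap.range_eq_bot]
  intro h0
  apply h
  ext u
  exact LinearMap.congr_fun h0 u

theorem norm_inner_diagVec_sq_le_gramRank (b : HilbertBasis ι 𝕜 E) (b₁ : HilbertBasis κ 𝕜 F)
    {A B : F →L[𝕜] E} (hB : IsHilbertSchmidt b₁ B) (J : Set ι) (n : ℕ)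
    (hn : gramRank b J A = n) (v : E) (hv : ∀ x, x ∉ J → inner 𝕜 (b x) v = 0) :
    ‖inner 𝕜 (diagVec b (A ∘L transpose b₁ b B)) v‖ ^ 2 ≤
      n * RCLike.re (inner 𝕜 v (schurProd b b (A ∘L adjoint A) (B ∘L adjoint B) v)) := by
  rw [gramRank_eq] at hn
  set W := LinearMap.range
      ((adjoint A ∘L (Submodule.span 𝕜 (b '' J)).topologicalClosure.starProjection :
        E →L[𝕜] F) : E →ₗ[𝕜] F) with hWdef
  have hr : Module.rank 𝕜 W = n := by simpa using hn
  have : FiniteDimensional 𝕜 W :=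
    Module.rank_lt_aleph0_iff.mp (hr ▸ Cardinal.natCast_lt_aleph0)
  have hf : Module.finrank 𝕜 W = n := Module.finrank_eq_of_rank_eq hr
  rw [← hf]
  refine norm_inner_diagVec_sq_le b b₁ hB W v fun x hx => ⟨b x, ?_⟩
  have hxJ : x ∈ J := by
    by_contra h
    exact hx (hv x h)
  simp [starProjection_basis_of_mem b hxJ]

/-- Together with `gramRank_le_card`, this ensures that the sharp example has enough basis vectors
in `J` and in the domain to realise the prescribed ranks. -/
theorem gramRank_le_encard (b : HilbertBasis ι 𝕜 E) (J : Set ι) (C : F →L[𝕜] E) :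
    gramRank b J C ≤ J.encard := by
  rcases J.finite_or_infinite with hJ | hJ
  swap
  · simp [hJ.encard_eq]
  have hfin : (b '' J).Finite := hJ.image b
  have := FiniteDimensional.span_of_finite 𝕜 hfin
  set P := (Submodule.span 𝕜 (b '' J)).topologicalClosure.starProjection with hP
  have hle : LinearMap.range ((compression b J (C ∘L adjoint C)) : E →ₗ[𝕜] E) ≤
      Submodule.span 𝕜 (b '' J) := by
    rintro _ ⟨u, rfl⟩
    have := Submodule.starProjection_apply_mem (Submodule.span 𝕜 (b '' J)).topologicalClosure
      ((C ∘L adjoint C) (P u))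
    exact (Submodule.closed_of_finiteDimensional _).submodule_topologicalClosure_eq.le this
  have h := (Submodule.rank_mono hle).trans (rank_span_le _)
  have h2 : Cardinal.toENat (Module.rank 𝕜
      (LinearMap.range ((compression b J (C ∘L adjoint C)) : E →ₗ[𝕜] E))) ≤ (b '' J).encard :=
    OrderHomClass.mono Cardinal.toENat h
  exact h2.trans (Set.encard_image_le _ _)

theorem gramRank_le_card (b : HilbertBasis ι 𝕜 E) (b₁ : HilbertBasis κ 𝕜 F) (J : Set ι)
    (C : F →L[𝕜] E) : gramRank b J C ≤ ENat.card κ := by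
  rcases finite_or_infinite κ with hκ | hκ
  swap
  · simp
  have := Fintype.ofFinite κ
  rw [gramRank_eq]
  set W := LinearMap.range
      ((adjoint C ∘L (Submodule.span 𝕜 (b '' J)).topologicalClosure.starProjection :
        E →L[𝕜] F) : E →ₗ[𝕜] F)
  have h1 : Module.rank 𝕜 F = Fintype.card κ := rank_eq_card_basis b₁.toOrthonormalBasis.toBasis
  have h : Cardinal.toENat (Module.rank 𝕜 W) ≤ Cardinal.toENat (Fintype.card κ : Cardinal) :=
    OrderHomClass.mono Cardinal.toENat ((Submodule.rank_le W).trans_eq h1)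
  refine h.trans ?_
  simp

end General

end HilbertSchur

namespace HilbertSchur

noncomputable section

/-! ### Diagonal operators along two injective families of basis vectors. -/

section Diagonal

variable {𝕜 : Type*} [RCLike 𝕜]
  {E : Type*} [NormedAddCommGroup E] [InnerProductSpace 𝕜 E] [CompleteSpace E]
  {F : Type*} [NormedAddCommGroup F] [InnerProductSpace 𝕜 F] [CompleteSpace F]
  {G : Type*} [NormedAddCommGroup G] [InnerProductSpace 𝕜 G] [CompleteSpace G]
  {ι : Type*} {κ : Type*} {N : Type*}

/-- The operator `∑ k, α k • e_{x k} f_{y k}*`, with `α` absolutely summable. -/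
def diagOp (b : HilbertBasis ι 𝕜 E) (b₁ : HilbertBasis κ 𝕜 F) (x : N → ι) (y : N → κ)
    (α : N → 𝕜) : F →L[𝕜] E :=
  ∑' k, α k • InnerProductSpace.rankOne 𝕜 (b (x k)) (b₁ (y k))

variable (b : HilbertBasis ι 𝕜 E) (b₁ : HilbertBasis κ 𝕜 F) {x : N → ι} {y : N → κ}
  {α β : N → 𝕜}

theorem hasSum_diagOp (hα : Summable fun k => ‖α k‖) :
    HasSum (fun k => α k • InnerProductSpace.rankOne 𝕜 (b (x k)) (b₁ (y k)))
      (diagOp b b₁ x y α) := by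
  refine Summable.hasSum (Summable.of_norm ?_)
  simpa [norm_smul, b.orthonormal.1, b₁.orthonormal.1] using hα

theorem hasSum_diagOp_apply (hα : Summable fun k => ‖α k‖) (u : F) :
    HasSum (fun k => (α k * inner 𝕜 (b₁ (y k)) u) • b (x k)) (diagOp b b₁ x y α u) := by
  simpa [mul_smul] using (hasSum_diagOp b b₁ (x := x) (y := y) hα).mapL (apply 𝕜 E u)

theorem adjoint_diagOp (hα : Summable fun k => ‖α k‖) :
    adjoint (diagOp b b₁ x y α) = diagOp b₁ b y x (fun k => star (α k)) := by
  have h := (hasSum_diagOp b b₁ (x := x) (y := y) hα).map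
    (adjoint : (F →L[𝕜] E) ≃ₗᵢ⋆[𝕜] (E →L[𝕜] F)) (LinearIsometryEquiv.continuous _)
  refine h.unique ?_
  convert! hasSum_diagOp b₁ b (x := y) (y := x) (α := fun k => star (α k)) (by simpa using hα)
    using 2
  rw [Function.comp_apply, map_smulₛₗ, InnerProductSpace.adjoint_rankOne]
  rfl

theorem diagOp_basis (hα : Summable fun k => ‖α k‖) (hy : Function.Injective y) (k : N) :
    diagOp b b₁ x y α (b₁ (y k)) = α k • b (x k) := by
  classical
  rw [← (hasSum_diagOp_apply b b₁ hα _).tsum_eq, tsum_eq_single k]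
  · simp [b₁.orthonormal.1]
  · intro j hj
    rw [b₁.orthonormal.2 (hy.ne hj)]
    simp

theorem diagOp_basis_of_notMem (hα : Summable fun k => ‖α k‖) {j : κ} (hj : j ∉ Set.range y) :
    diagOp b b₁ x y α (b₁ j) = 0 := by
  rw [← (hasSum_diagOp_apply b b₁ hα _).tsum_eq]
  refine (tsum_congr fun k => ?_).trans tsum_zero
  rw [b₁.orthonormal.2 fun h => hj ⟨k, h⟩]
  simp

theorem isHilbertSchmidt_diagOp (hα : Summable fun k => ‖α k‖) (hy : Function.Injective y) :
    IsHilbertSchmidt b₁ (diagOp b b₁ x y α) := by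
  unfold IsHilbertSchmidt
  rw [← hy.summable_iff]
  · simp only [Function.comp_def, diagOp_basis b b₁ hα hy, norm_smul, b.orthonormal.1, mul_one]
    -- Absolutely summable weights are square-summable: `|α_k|² ≤ (∑ |α_j|) |α_k|`.
    refine Summable.of_nonneg_of_le (fun _ => sq_nonneg _) (fun k => ?_)
      (hα.mul_left (∑' k, ‖α k‖))
    rw [sq]
    gcongr
    exact hα.le_tsum k fun _ _ => norm_nonneg _
  · intro j hj
    simp [diagOp_basis_of_notMem b b₁ hα hj]

/-- The range contains `e_{x_k}` for every `k` in the support, and for finite support it lies in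
their span. For infinite support the independent family alone forces the value `⊤`. -/
theorem toENat_rank_range_diagOp (hα : Summable fun k => ‖α k‖) (hx : Function.Injective x)
    (hy : Function.Injective y) :
    Cardinal.toENat (Module.rank 𝕜 (LinearMap.range (diagOp b b₁ x y α : F →ₗ[𝕜] E))) =
      (Function.support α).encard := by
  apply le_antisymm
  · rcases (Function.support α).finite_or_infinite with hfin | hinf
    swap
    · simp [hinf.encard_eq]
    have hle : LinearMap.range (diagOp b b₁ x y α : F →ₗ[𝕜] E) ≤
        Submodule.span 𝕜 ((fun k => b (x k)) '' Function.support α) := by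
      rintro _ ⟨u, rfl⟩
      rw [coe_coe, ← (hasSum_diagOp_apply b b₁ hα u).tsum_eq, tsum_eq_sum (s := hfin.toFinset)]
      · refine Submodule.sum_mem _ fun k hk => Submodule.smul_mem _ _ (Submodule.subset_span ?_)
        exact ⟨k, by simpa using hk, rfl⟩
      · intro k hk
        simp_all
    have h := OrderHomClass.mono Cardinal.toENat
      ((Submodule.rank_mono hle).trans (rank_span_le _))
    exact LE.le.trans h (Set.encard_image_le _ _)
  · let v : Function.support α → LinearMap.range (diagOp b b₁ x y α : F →ₗ[𝕜] E) := fun k =>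
      ⟨b (x k), (α k)⁻¹ • b₁ (y k), by
        simp [diagOp_basis b b₁ hα hy, smul_smul, inv_mul_cancel₀ k.2]⟩
    have hv : LinearIndependent 𝕜 v := by
      apply LinearIndependent.of_comp (Submodule.subtype _)
      exact b.orthonormal.linearIndependent.comp (fun k : Function.support α => x k)
        (hx.comp Subtype.val_injective)
    have h := OrderHomClass.mono Cardinal.toENat hv.cardinal_lift_le_rank
    simpa using h

theorem gramRank_diagOp (hα : Summable fun k => ‖α k‖) (hx : Function.Injective x)
    (hy : Function.Injective y) {J : Set ι} (hJ : ∀ k, x k ∈ J) :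
    gramRank b J (diagOp b b₁ x y α) = (Function.support α).encard := by
  have hα' : Summable fun k => ‖star (α k)‖ := by simpa using hα
  have e : adjoint (diagOp b b₁ x y α) ∘L
      (Submodule.span 𝕜 (b '' J)).topologicalClosure.starProjection =
      diagOp b₁ b y x (fun k => star (α k)) := by
    rw [adjoint_diagOp b b₁ hα]
    refine ext_basis b fun i => ?_
    rw [ContinuousLinearMap.comp_apply]
    by_cases hi : i ∈ J
    · rw [starProjection_basis_of_mem b hi]
    · rw [starProjection_basis_of_notMem b hi, map_zero, diagOp_basis_of_notMem b₁ b hα']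
      rintro ⟨k, rfl⟩
      exact hi (hJ k)
  rw [gramRank_eq, e, toENat_rank_range_diagOp b₁ b hα' hy hx]
  congr 1
  ext k
  simp

/-- Only the overlap of the two supports is seen. The finite set `T` contains it, so the sum is
finite even when both operators have infinite rank. -/
theorem diagVec_diagOp (hα : Summable fun k => ‖α k‖) (hβ : Summable fun k => ‖β k‖)
    (hx : Function.Injective x) (hy : Function.Injective y) {T : Finset N}
    (hT : ∀ k ∉ T, α k * β k = 0) :
    diagVec b (diagOp b b₁ x y α ∘L transpose b₁ b (diagOp b b₁ x y β)) =
      ∑ k ∈ T, (α k * β k) • b (x k) := by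
  classical
  have hα' : Summable fun k => ‖star (α k)‖ := by simpa using hα
  have hβ' : Summable fun k => ‖star (β k)‖ := by simpa using hβ
  refine ext_inner_basis b fun i => ?_
  rw [inner_diagVec_comp_transpose b₁ b _ _ (isHilbertSchmidt_diagOp b b₁ hβ hy),
    adjoint_diagOp b b₁ hα, adjoint_diagOp b b₁ hβ]
  by_cases hi : i ∈ Set.range x
  · obtain ⟨k, rfl⟩ := hi
    rw [diagOp_basis b₁ b hα' hx, diagOp_basis b₁ b hβ' hx]
    simp only [map_smulₛₗ, conjVec_basis, inner_smul_left, inner_smul_right, inner_sum,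
      orthonormal_iff_ite.mp b.orthonormal, inner_self_eq_norm_sq_to_K, b₁.orthonormal.1,
      hx.eq_iff]
    by_cases hk : k ∈ T
    · simp [hk, mul_comm]
    · have := hT k hk
      rcases mul_eq_zero.mp this with h | h <;> simp [hk, h]
  · rw [diagOp_basis_of_notMem b₁ b hα' hi, inner_zero_left, inner_sum]
    refine (Finset.sum_eq_zero fun k _ => ?_).symm
    rw [inner_smul_right, b.orthonormal.2 fun h => hi ⟨k, h.symm⟩, mul_zero]

theorem schurProd_diagOp (hα : Summable fun k => ‖α k‖) (hβ : Summable fun k => ‖β k‖)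
    (hx : Function.Injective x) (hy : Function.Injective y) {T : Finset N}
    (hT : ∀ k ∉ T, α k * β k = 0) :
    schurProd b b (diagOp b b₁ x y α ∘L adjoint (diagOp b b₁ x y α))
        (diagOp b b₁ x y β ∘L adjoint (diagOp b b₁ x y β)) =
      ∑ k ∈ T, (‖α k * β k‖ ^ 2 : 𝕜) • InnerProductSpace.rankOne 𝕜 (b (x k)) (b (x k)) := by
  classical
  have hα' : Summable fun k => ‖star (α k)‖ := by simpa using hα
  have hβ' : Summable fun k => ‖star (β k)‖ := by simpa using hβ
  refine ext_entries b b fun i j => ?_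
  rw [inner_schurProd, adjoint_diagOp b b₁ hα, adjoint_diagOp b b₁ hβ,
    ContinuousLinearMap.comp_apply, ContinuousLinearMap.comp_apply]
  by_cases hi : i ∈ Set.range x
  · obtain ⟨k, rfl⟩ := hi
    rw [diagOp_basis b₁ b hα' hx, diagOp_basis b₁ b hβ' hx]
    simp only [map_smul, diagOp_basis b b₁ hα hy, diagOp_basis b b₁ hβ hy, inner_smul_right,
      sum_apply, inner_sum, smul_apply, InnerProductSpace.rankOne_apply]
    have e : (‖α k * β k‖ ^ 2 : 𝕜) = star (α k) * α k * (star (β k) * β k) := by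
      rw [norm_mul]
      push_cast
      rw [mul_pow, ← RCLike.conj_mul, ← RCLike.conj_mul]
      rfl
    rw [Finset.sum_eq_single k, e]
    · simp only [orthonormal_iff_ite.mp b.orthonormal]
      by_cases hj : j = x k
      · simp only [hj, if_true]
        ring
      · simp [hj]
    · intro l _ hl
      rw [b.orthonormal.2 (hx.ne hl)]
      simp
    · intro hk
      rw [hT k hk]
      simp
  · rw [diagOp_basis_of_notMem b₁ b hα' hi, map_zero, inner_zero_right, zero_mul]
    simp only [sum_apply, inner_sum, smul_apply, InnerProductSpace.rankOne_apply,
      inner_smul_right]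
    refine (Finset.sum_eq_zero fun k _ => ?_).symm
    rw [b.orthonormal.2 fun h => hi ⟨k, h⟩]
    simp

/-- On the left the `|T|` unit terms are added before squaring, on the right after; this is the
equality case of Cauchy–Schwarz. -/
theorem mul_card_sq_le_of_schurLowerBound_diagOp (hα : Summable fun k => ‖α k‖)
    (hβ : Summable fun k => ‖β k‖) (hx : Function.Injective x) (hy : Function.Injective y)
    {T : Finset N} (hT : ∀ k ∉ T, α k * β k = 0) {C₃ : G →L[𝕜] E} {u : G}
    (hu : ∀ k ∈ T, star (α k * β k) * inner 𝕜 (b (x k)) (C₃ u) = 1) {c : ℝ}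
    (h : SchurLowerBound b b₁ (diagOp b b₁ x y α) (diagOp b b₁ x y β) C₃ c) :
    c * (T.card : ℝ) ^ 2 ≤ T.card := by
  have h := (schurLowerBound_iff b b₁ _ _ C₃ c).mp h u
  rw [diagVec_diagOp b b₁ hα hβ hx hy hT, schurProd_diagOp b b₁ hα hβ hx hy hT] at h
  have e₁ : inner 𝕜 (∑ k ∈ T, (α k * β k) • b (x k)) (C₃ u) = (T.card : 𝕜) := by
    rw [sum_inner, Finset.sum_congr rfl (g := fun _ => (1 : 𝕜))]
    · simp
    · intro k hk
      rw [inner_smul_left]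
      exact hu k hk
  have e₂ : inner 𝕜 (C₃ u) ((∑ k ∈ T, (‖α k * β k‖ ^ 2 : 𝕜) •
      InnerProductSpace.rankOne 𝕜 (b (x k)) (b (x k))) (C₃ u)) = (T.card : 𝕜) := by
    simp only [sum_apply, inner_sum, smul_apply, InnerProductSpace.rankOne_apply,
      inner_smul_right]
    rw [Finset.sum_congr rfl (g := fun _ => (1 : 𝕜))]
    · simp
    · intro k hk
      rw [← inner_conj_symm (C₃ u), RCLike.mul_conj]
      have := congrArg (fun z => ‖z‖) (hu k hk)
      simp only [norm_mul, norm_star, norm_one] at this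
      rw [← mul_pow, norm_mul]
      norm_cast
      rw [this, one_pow]
  rw [e₁, e₂] at h
  simpa using h

end Diagonal

/-! ### Choice of the indices and weights -/

/-- Supports of sizes `r` and `s` whose overlap has exactly `m` elements: nested initial segments of
`ℕ` if `r = m`; if both sizes are infinite, the first `m` numbers together with all even,
respectively all odd, numbers. -/
theorem exists_index_sets {r s : ℕ∞} {m : ℕ} (h : r = m ∧ r ≤ s ∨ r = ⊤ ∧ s = ⊤) :
    ∃ K₁ K₂ : Set ℕ, K₁.encard = r ∧ K₂.encard = s ∧ K₁ ∩ K₂ = Set.Iio m ∧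
      (K₁ ∪ K₂).encard ≤ s := by
  rcases h with ⟨rfl, hs⟩ | ⟨rfl, rfl⟩
  · obtain ⟨K, hK, hKs⟩ : ∃ K : Set ℕ, K.encard = s ∧ Set.Iio m ⊆ K := by
      induction s using ENat.recTopCoe with
      | top => exact ⟨Set.univ, by simp, Set.subset_univ _⟩
      | coe n => exact ⟨Set.Iio n, by simp [← Finset.coe_Iio],
          Set.Iio_subset_Iio (by exact_mod_cast hs)⟩
    refine ⟨Set.Iio m, K, by simp [← Finset.coe_Iio], hK, Set.inter_eq_left.mpr hKs, ?_⟩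
    rw [Set.union_eq_right.mpr hKs, hK]
  · have hinf : ∀ f : ℕ → ℕ, Function.Injective f → (Set.Iio m ∪ Set.range f).encard = ⊤ :=
      fun f hf => Set.encard_eq_top_iff.mpr
        ((Set.infinite_range_of_injective hf).mono Set.subset_union_right)
    refine ⟨_, _, hinf (fun k => 2 * k) fun _ _ h => by simpa using h,
      hinf (fun k => 2 * k + 1) fun _ _ h => by simpa using h, ?_, le_top⟩
    rw [← Set.union_inter_distrib_left, Set.union_eq_left]
    rintro n ⟨⟨i, hi⟩, ⟨j, hj⟩⟩
    simp only at hi hj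
    omega

theorem exists_injective_of_encard_le {X : Type*} {K : Set ℕ} {J : Set X}
    (h : K.encard ≤ J.encard) : ∃ x : K → X, Function.Injective x ∧ ∀ k, x k ∈ J := by
  rcases J.finite_or_infinite with hJ | hJ
  · have hK : K.Finite := Set.encard_lt_top_iff.mp (h.trans_lt (Set.encard_lt_top_iff.mpr hJ))
    have := hK.fintype
    have := hJ.fintype
    obtain ⟨f⟩ : Nonempty (K ↪ J) := Function.Embedding.nonempty_of_card_le (by
      have := h
      rw [← Set.coe_fintypeCard, ← Set.coe_fintypeCard] at this
      exact_mod_cast this)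
    exact ⟨fun k => f k, Subtype.val_injective.comp f.injective, fun k => (f k).2⟩
  · refine ⟨fun k => hJ.natEmbedding J k, ?_, fun k => (hJ.natEmbedding J k).2⟩
    exact (Subtype.val_injective.comp (hJ.natEmbedding J).injective).comp Subtype.val_injective

/-- The values below `m` are free, being finitely many. The rest of `K₁` is filled with a geometric
sequence, which gives the support its full size and preserves summability. -/
theorem exists_summable_weights {𝕜 : Type*} [RCLike 𝕜] {K K₁ : Set ℕ} {m : ℕ} (hK : K₁ ⊆ K)
    (hm : Set.Iio m ⊆ K₁) (a : K → 𝕜) (ha : ∀ k : K, (k : ℕ) < m → a k ≠ 0) :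
    ∃ α : K → 𝕜, (Summable fun k => ‖α k‖) ∧ (Function.support α).encard = K₁.encard ∧
      (∀ k : K, (k : ℕ) ∉ K₁ → α k = 0) ∧ ∀ k : K, (k : ℕ) < m → α k = a k := by
  classical
  refine ⟨fun k => if (k : ℕ) < m then a k else if (k : ℕ) ∈ K₁ then (1 / 2) ^ (k : ℕ) else 0,
    ?_, ?_, ?_, fun k hk => if_pos hk⟩
  · refine Summable.of_norm_bounded_eventually (g := fun k : K => (1 / 2 : ℝ) ^ (k : ℕ))
      (summable_geometric_two.subtype K) ?_
    have hf : {k : K | (k : ℕ) < m}.Finite :=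
      (Set.finite_Iio m).preimage Subtype.val_injective.injOn
    filter_upwards [hf.compl_mem_cofinite] with k hk
    have hk' : ¬ (k : ℕ) < m := hk
    simp only [if_neg hk', norm_norm]
    split_ifs <;> simp
  · have : (Function.support fun k : K => if (k : ℕ) < m then a k else
        if (k : ℕ) ∈ K₁ then (1 / 2 : 𝕜) ^ (k : ℕ) else 0) = Subtype.val ⁻¹' K₁ := by
      ext k
      rw [Function.mem_support, Set.mem_preimage]
      split_ifs with h1 h2
      · simp [ha k h1, hm h1]
      · simp [h2]
      · simp [h2]
    rw [this, Set.encard_preimage_of_injective_subset_range Subtype.val_injective]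
    simpa using hK
  · intro k hk
    have hk' : ¬ (k : ℕ) < m := fun h => hk (hm h)
    simp only [if_neg hk', if_neg hk]

end

end HilbertSchur

namespace HilbertSchur

/-! ### Optimality of the coefficient, and the case distinction on the ranks. -/

section Sharpness

variable {𝕜 : Type*} [RCLike 𝕜]
  {H : Type*} [NormedAddCommGroup H] [InnerProductSpace 𝕜 H] [CompleteSpace H]
  {H₁ : Type*} [NormedAddCommGroup H₁] [InnerProductSpace 𝕜 H₁] [CompleteSpace H₁]
  {H₂ : Type*} [NormedAddCommGroup H₂] [InnerProductSpace 𝕜 H₂] [CompleteSpace H₂]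
  {X : Type*} {Y : Type*}

/-- Operators with prescribed ranks `r, s` for which no coefficient above `1 / m` is admissible. -/
theorem exists_pair_mul_sq_le (b : HilbertBasis X 𝕜 H) (b₁ : HilbertBasis Y 𝕜 H₁)
    (C₃ : H₂ →L[𝕜] H) {r s : ℕ∞} {m : ℕ} (h : r = m ∧ r ≤ s ∨ r = ⊤ ∧ s = ⊤)
    (hX : s ≤ (rowSupport b C₃).encard) (hY : s ≤ ENat.card Y) :
    ∃ A B : H₁ →L[𝕜] H, IsHilbertSchmidt b₁ A ∧ IsHilbertSchmidt b₁ B ∧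
      gramRank b (rowSupport b C₃) A = r ∧ gramRank b (rowSupport b C₃) B = s ∧
      ∀ c : ℝ, SchurLowerBound b b₁ A B C₃ c → c * (m : ℝ) ^ 2 ≤ m := by
  classical
  obtain ⟨K₁, K₂, hK₁, hK₂, hK, hKs⟩ := exists_index_sets h
  have hm₁ : Set.Iio m ⊆ K₁ := hK ▸ Set.inter_subset_left
  have hm₂ : Set.Iio m ⊆ K₂ := hK ▸ Set.inter_subset_right
  obtain ⟨x, hx, hxJ⟩ := exists_injective_of_encard_le (hKs.trans hX)
  obtain ⟨y, hy, -⟩ := exists_injective_of_encard_le (J := (Set.univ : Set Y))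
    (hKs.trans (by rwa [Set.encard_univ]))
  let T : Finset ↥(K₁ ∪ K₂) := ((Set.finite_Iio m).preimage Subtype.val_injective.injOn).toFinset
  have hTm : ∀ k : ↥(K₁ ∪ K₂), k ∈ T ↔ (k : ℕ) < m := fun k => by simp [T]
  have hTc : T.card = m := by
    have : T.map (Function.Embedding.subtype _) = Finset.range m := by
      ext k
      simp only [Finset.mem_map, hTm, Finset.mem_range, Function.Embedding.coe_subtype]
      exact ⟨fun ⟨j, hj, e⟩ => e ▸ hj, fun hk => ⟨⟨k, Or.inl (hm₁ hk)⟩, hk, rfl⟩⟩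
    rw [← Finset.card_map, this, Finset.card_range]
  -- Each `x k` lies in the row support, so `u ↦ ⟨e_{x k}, C₃ u⟩` is a nonzero functional. Finitely
  -- many nonzero functionals over an infinite field have a common point where none vanishes.
  obtain ⟨u, hu⟩ := Module.Dual.exists_forall_ne_zero_of_forall_exists
    (fun k : T => (innerSL 𝕜 (adjoint C₃ (b (x k))) : H₂ →ₗ[𝕜] 𝕜))
    fun k => ⟨adjoint C₃ (b (x k)), inner_self_ne_zero.mpr (hxJ k)⟩
  have hu' : ∀ k ∈ T, inner 𝕜 (b (x k)) (C₃ u) ≠ 0 := fun k hk => by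
    rw [← adjoint_inner_left]
    exact hu ⟨k, hk⟩
  -- The weights on the overlap are chosen so that `star (α k * β k) * ⟨e_{x k}, C₃ u⟩ = 1`, with `β
  -- k = 1` there. The weights elsewhere only bring the ranks up to `r` and `s`.
  obtain ⟨α, hα, hαs, hα0, hαm⟩ := exists_summable_weights (𝕜 := 𝕜)
    (Set.subset_union_left : K₁ ⊆ K₁ ∪ K₂) hm₁
    (fun k => star (inner 𝕜 (b (x k)) (C₃ u))⁻¹)
    fun k hk => star_ne_zero.mpr (inv_ne_zero (hu' k ((hTm k).mpr hk)))
  obtain ⟨β, hβ, hβs, hβ0, hβm⟩ := exists_summable_weights (𝕜 := 𝕜)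
    (Set.subset_union_right : K₂ ⊆ K₁ ∪ K₂) hm₂ (fun _ => 1) fun _ _ => one_ne_zero
  have hT : ∀ k ∉ T, α k * β k = 0 := fun k hk => by
    by_cases h1 : (k : ℕ) ∈ K₁
    · by_cases h2 : (k : ℕ) ∈ K₂
      · exact absurd ((hTm k).mpr (hK.le ⟨h1, h2⟩)) hk
      · rw [hβ0 k h2, mul_zero]
    · rw [hα0 k h1, zero_mul]
  refine ⟨diagOp b b₁ x y α, diagOp b b₁ x y β, isHilbertSchmidt_diagOp b b₁ hα hy,
    isHilbertSchmidt_diagOp b b₁ hβ hy, ?_, ?_, fun c hc => ?_⟩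
  · rw [gramRank_diagOp b b₁ hα hx hy hxJ, hαs, hK₁]
  · rw [gramRank_diagOp b b₁ hβ hx hy hxJ, hβs, hK₂]
  · rw [← hTc]
    refine mul_card_sq_le_of_schurLowerBound_diagOp b b₁ hα hβ hx hy hT (u := u) ?_ hc
    intro k hk
    rw [hαm k ((hTm k).mp hk), hβm k ((hTm k).mp hk), mul_one, star_star,
      inv_mul_cancel₀ (hu' k hk)]

theorem gammaCoeff_comm (b : HilbertBasis X 𝕜 H) (J : Set X) (C₁ C₂ : H₁ →L[𝕜] H) :
    gammaCoeff b J C₁ C₂ = gammaCoeff b J C₂ C₁ := by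
  unfold gammaCoeff
  rw [min_comm]

theorem gammaCoeff_of_eq_natCast (b : HilbertBasis X 𝕜 H) (J : Set X) (C₁ C₂ : H₁ →L[𝕜] H)
    (h : gramRank b J C₁ ≤ gramRank b J C₂) {n : ℕ} (hn : gramRank b J C₁ = n) :
    gammaCoeff b J C₁ C₂ = (n : ℝ)⁻¹ := by
  unfold gammaCoeff
  rw [min_eq_left h, hn]
  simp

theorem gammaCoeff_of_eq_top (b : HilbertBasis X 𝕜 H) (J : Set X) (C₁ C₂ : H₁ →L[𝕜] H)
    (h₁ : gramRank b J C₁ = ⊤) (h₂ : gramRank b J C₂ = ⊤) : gammaCoeff b J C₁ C₂ = 0 := by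
  unfold gammaCoeff
  rw [h₁, h₂]
  simp

/-- The theorem for ranks in increasing order, the smaller of which is finite. -/
theorem schurLowerBound_and_sharp_of_natCast (b : HilbertBasis X 𝕜 H) (b₁ : HilbertBasis Y 𝕜 H₁)
    (C₁ C₂ : H₁ →L[𝕜] H) (C₃ : H₂ →L[𝕜] H) (h₂ : IsHilbertSchmidt b₁ C₂) {n : ℕ}
    (hn : gramRank b (rowSupport b C₃) C₁ = n) (hn0 : n ≠ 0)
    (hle : gramRank b (rowSupport b C₃) C₁ ≤ gramRank b (rowSupport b C₃) C₂) :
    SchurLowerBound b b₁ C₁ C₂ C₃ (gammaCoeff b (rowSupport b C₃) C₁ C₂) ∧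
    0 < gammaCoeff b (rowSupport b C₃) C₁ C₂ ∧
    ∃ A B : H₁ →L[𝕜] H, IsHilbertSchmidt b₁ A ∧ IsHilbertSchmidt b₁ B ∧
      gramRank b (rowSupport b C₃) A = gramRank b (rowSupport b C₃) C₁ ∧
      gramRank b (rowSupport b C₃) B = gramRank b (rowSupport b C₃) C₂ ∧
      ∀ c : ℝ, SchurLowerBound b b₁ A B C₃ c → c ≤ gammaCoeff b (rowSupport b C₃) C₁ C₂ := by
  have hpos : (0 : ℝ) < n := by exact_mod_cast Nat.pos_of_ne_zero hn0
  rw [gammaCoeff_of_eq_natCast b _ C₁ C₂ hle hn]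
  refine ⟨?_, by positivity, ?_⟩
  · rw [schurLowerBound_iff]
    intro u
    rw [inv_mul_le_iff₀ hpos]
    refine norm_inner_diagVec_sq_le_gramRank b b₁ h₂ (rowSupport b C₃) n hn (C₃ u) fun x hx => ?_
    rw [← adjoint_inner_left, not_not.mp hx, inner_zero_left]
  -- The room for rank `s` is guaranteed by `C₂`, which already realises it.
  · obtain ⟨A, B, hA, hB, hAr, hBr, hc⟩ := exists_pair_mul_sq_le b b₁ C₃ (Or.inl ⟨hn, hle⟩)
      (gramRank_le_encard b _ C₂) (gramRank_le_card b b₁ _ C₂)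
    refine ⟨A, B, hA, hB, hAr, hBr, fun c hlb => ?_⟩
    have := hc c hlb
    rw [← one_div, le_div_iff₀ hpos]
    nlinarith

theorem schurLowerBound_and_sharp_of_ne_top (b : HilbertBasis X 𝕜 H) (b₁ : HilbertBasis Y 𝕜 H₁)
    (C₁ C₂ : H₁ →L[𝕜] H) (C₃ : H₂ →L[𝕜] H) (h₁ : IsHilbertSchmidt b₁ C₁)
    (h₂ : IsHilbertSchmidt b₁ C₂) (hne₁ : gramRank b (rowSupport b C₃) C₁ ≠ 0)
    (hne₂ : gramRank b (rowSupport b C₃) C₂ ≠ 0)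
    (hfin : gramRank b (rowSupport b C₃) C₁ ≠ ⊤ ∨ gramRank b (rowSupport b C₃) C₂ ≠ ⊤) :
    SchurLowerBound b b₁ C₁ C₂ C₃ (gammaCoeff b (rowSupport b C₃) C₁ C₂) ∧
    0 < gammaCoeff b (rowSupport b C₃) C₁ C₂ ∧
    ∃ A B : H₁ →L[𝕜] H, IsHilbertSchmidt b₁ A ∧ IsHilbertSchmidt b₁ B ∧
      gramRank b (rowSupport b C₃) A = gramRank b (rowSupport b C₃) C₁ ∧
      gramRank b (rowSupport b C₃) B = gramRank b (rowSupport b C₃) C₂ ∧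
      ∀ c : ℝ, SchurLowerBound b b₁ A B C₃ c → c ≤ gammaCoeff b (rowSupport b C₃) C₁ C₂ := by
  rcases le_total (gramRank b (rowSupport b C₃) C₁) (gramRank b (rowSupport b C₃) C₂) with hle | hle
  · obtain ⟨n, hn⟩ := ENat.ne_top_iff_exists.mp
      (hfin.elim id fun h => ne_top_of_le_ne_top h hle)
    exact schurLowerBound_and_sharp_of_natCast b b₁ C₁ C₂ C₃ h₂ hn.symm
      (by rintro rfl; exact hne₁ (by simpa using hn.symm)) hle
  · obtain ⟨n, hn⟩ := ENat.ne_top_iff_exists.mp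
      (hfin.elim (fun h => ne_top_of_le_ne_top h hle) id)
    obtain ⟨hlb, hpos, A, B, hA, hB, hAr, hBr, hc⟩ :=
      schurLowerBound_and_sharp_of_natCast b b₁ C₂ C₁ C₃ h₁ hn.symm
        (by rintro rfl; exact hne₂ (by simpa using hn.symm)) hle
    rw [gammaCoeff_comm]
    exact ⟨(schurLowerBound_comm b b₁ h₂ h₁ C₃ _).mp hlb, hpos, B, A, hB, hA, hBr, hAr,
      fun c h => hc c ((schurLowerBound_comm b b₁ hB hA C₃ c).mp h)⟩

theorem schurLowerBound_zero (b : HilbertBasis X 𝕜 H) (b₁ : HilbertBasis Y 𝕜 H₁)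
    (C₁ C₂ : H₁ →L[𝕜] H) (C₃ : H₂ →L[𝕜] H) : SchurLowerBound b b₁ C₁ C₂ C₃ 0 := by
  rw [schurLowerBound_iff]
  intro u
  rw [zero_mul]
  exact re_inner_schurProd_nonneg b C₁ C₂ (C₃ u)

end Sharpness

end HilbertSchur

open HilbertSchur in
theorem mainTheorem7
    {𝕜 : Type*} [RCLike 𝕜]
    {H : Type*} [NormedAddCommGroup H] [InnerProductSpace 𝕜 H] [CompleteSpace H]
    {H₁ : Type*} [NormedAddCommGroup H₁] [InnerProductSpace 𝕜 H₁] [CompleteSpace H₁]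
    {H₂ : Type*} [NormedAddCommGroup H₂] [InnerProductSpace 𝕜 H₂] [CompleteSpace H₂]
    {X Y Z : Type*}
    (b : HilbertBasis X 𝕜 H) (b₁ : HilbertBasis Y 𝕜 H₁) (b₂ : HilbertBasis Z 𝕜 H₂)
    (C₁ C₂ : H₁ →L[𝕜] H) (C₃ : H₂ →L[𝕜] H)
    (h₁ : IsHilbertSchmidt b₁ C₁) (h₂ : IsHilbertSchmidt b₁ C₂) (h₃ : IsHilbertSchmidt b₂ C₃)
    (J : Set X) (hJ : J = rowSupport b C₃)
    (hne₁ : compression b J (C₁ ∘L ContinuousLinearMap.adjoint C₁) ≠ 0)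
    (hne₂ : compression b J (C₂ ∘L ContinuousLinearMap.adjoint C₂) ≠ 0) :
    -- the lower bound
    SchurLowerBound b b₁ C₁ C₂ C₃ (gammaCoeff b J C₁ C₂) ∧
    -- the coefficient is nonzero as soon as one of the two ranks is finite
    (gramRank b J C₁ ≠ ⊤ ∨ gramRank b J C₂ ≠ ⊤ → 0 < gammaCoeff b J C₁ C₂) ∧
    -- best possible: no larger coefficient works for all operators with the same two ranks
    (∀ c : ℝ, gammaCoeff b J C₁ C₂ < c →
      ∃ A B : H₁ →L[𝕜] H, IsHilbertSchmidt b₁ A ∧ IsHilbertSchmidt b₁ B ∧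
        gramRank b J A = gramRank b J C₁ ∧ gramRank b J B = gramRank b J C₂ ∧
        ¬ SchurLowerBound b b₁ A B C₃ c) ∧
    -- and if one of the ranks is finite, a single pair of operators excludes all of them
    (gramRank b J C₁ ≠ ⊤ ∨ gramRank b J C₂ ≠ ⊤ →
      ∃ A B : H₁ →L[𝕜] H, IsHilbertSchmidt b₁ A ∧ IsHilbertSchmidt b₁ B ∧
        gramRank b J A = gramRank b J C₁ ∧ gramRank b J B = gramRank b J C₂ ∧
        ∀ c : ℝ, SchurLowerBound b b₁ A B C₃ c → c ≤ gammaCoeff b J C₁ C₂) := by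
  subst hJ
  have hr₁ := gramRank_ne_zero b _ C₁ hne₁
  have hr₂ := gramRank_ne_zero b _ C₂ hne₂
  by_cases hfin : gramRank b (rowSupport b C₃) C₁ ≠ ⊤ ∨ gramRank b (rowSupport b C₃) C₂ ≠ ⊤
  · obtain ⟨hlb, hpos, A, B, hA, hB, hAr, hBr, hc⟩ :=
      schurLowerBound_and_sharp_of_ne_top b b₁ C₁ C₂ C₃ h₁ h₂ hr₁ hr₂ hfin
    exact ⟨hlb, fun _ => hpos, fun c hlt => ⟨A, B, hA, hB, hAr, hBr, fun h => (hc c h).not_gt hlt⟩,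
      fun _ => ⟨A, B, hA, hB, hAr, hBr, hc⟩⟩
  · have ht : gramRank b (rowSupport b C₃) C₁ = ⊤ ∧ gramRank b (rowSupport b C₃) C₂ = ⊤ := by
      simpa only [not_or, not_not, ne_eq] using hfin
    refine ⟨?_, fun h => absurd h hfin, fun c hlt => ?_, fun h => absurd h hfin⟩ <;>
      rw [gammaCoeff_of_eq_top b _ C₁ C₂ ht.1 ht.2] at *
    · exact schurLowerBound_zero b b₁ C₁ C₂ C₃
    -- With both ranks infinite the overlap may have any finite size; `c * m > 1` contradicts `c * m
    -- ^ 2 ≤ m`. The pair depends on `c` through `m`.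
    · obtain ⟨m, hm⟩ := exists_nat_gt c⁻¹
      obtain ⟨A, B, hA, hB, hAr, hBr, hAB⟩ := exists_pair_mul_sq_le b b₁ C₃ (m := m) (Or.inr ht)
        (gramRank_le_encard b _ C₂) (gramRank_le_card b b₁ _ C₂)
      refine ⟨A, B, hA, hB, hAr, hBr, fun h => ?_⟩
      have h1 := hAB c h
      have h2 : 1 < c * m := (inv_lt_iff_one_lt_mul₀' hlt).mp hm
      have h3 : (0 : ℝ) < m := (inv_pos.mpr hlt).trans hm
      nlinarith
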